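/- Let $\mathbb{K}$ be a field of characteristic $0$ and $\overline{\mathbb{K}}$ an algebraic closure of $\mathbb{K}$. Let $F(x,y)\in\mathbb{K}(x,y)$ be a rational function whose denominator (in lowest terms) does not vanish at $(0,0)$, let $F(x,y)=\sum_{i,j\ge 0}a_{i,j}x^iy^j$ be its expansion in $\mathbb{K}[[x,y]]$, and let $\operatorname{Diag}F(t)=\sum_{i\ge 0}a_{i,i}t^i\in\mathbb{K}[[t]]$ be its diagonal. Put $$G(t,y)=\frac1y\,F\!\left(\frac ty,\,y\right)\in\mathbb{K}(t)(y).$$ Then there is an integer $N\ge 1$ such that the denominator of $G$ (in lowest terms, as a polynomial in $y$ over $\mathbb{K}(t)$) splits into linear factors over $\overline{\mathbb{K}}((t^{1/N}))$. Moreover, if $\mathcal{P}$ denotes the (finite) set of its roots, that is, of the poles of $G$, then $$\operatorname{Diag}F(t)=\sum_{\substack{y(t)\in\mathcal{P}\\ \operatorname{val}_t(y(t))>0}}\operatorname{Residue}\bigl(G(t,y),\,y=y(t)\bigr).$$ Here $\operatorname{val}_t$ is the $t$-adic valuation, with $\operatorname{val}_t(0)=\infty$ (so $y=0$ belongs to the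 sum whenever it is a pole), and the residue at $y=y(t)$ is the coefficient of $z^{-1}$ in the Laurent expansion of $G(t,y(t)+z)$ at $z=0$. Each pole is counted once, whatever its multiplicity. -/

import Mathlib

noncomputable section

namespace DiagonalResidues

open Polynomial

/-! ### Bivariate rational functions and their diagonals -/

/-- The field `K(x, y)`; the variable `x` has index `0` and `y` has index `1`. -/
abbrev RatFunc₂ (K : Type*) [Field K] : Type _ := FractionRing (MvPolynomial (Fin 2) K)

/-- The numerator of `F` in lowest terms. -/
def numer {K : Type*} [Field K] (F : RatFunc₂ K) : MvPolynomial (Fin 2) K :=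
  IsFractionRing.num (MvPolynomial (Fin 2) K) F

/-- The denominator of `F` in lowest terms. -/
def denom {K : Type*} [Field K] (F : RatFunc₂ K) : MvPolynomial (Fin 2) K :=
  (IsFractionRing.den (MvPolynomial (Fin 2) K) F : MvPolynomial (Fin 2) K)

/-- The expansion of `F` in `K[[x, y]]`, for `F` whose denominator does not vanish at `(0, 0)`
(so that the denominator is invertible in `K[[x, y]]`). -/
def expansion {K : Type*} [Field K] (F : RatFunc₂ K) : MvPowerSeries (Fin 2) K :=
  (numer F : MvPowerSeries (Fin 2) K) * (denom F : MvPowerSeries (Fin 2) K)⁻¹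

/-- The diagonal `∑ a_{i,i} t^i` of a bivariate power series `∑ a_{i,j} x^i y^j`. -/
def diagSeries {K : Type*} [Field K] (f : MvPowerSeries (Fin 2) K) : PowerSeries K :=
  PowerSeries.mk fun i =>
    MvPowerSeries.coeff (Finsupp.single (0 : Fin 2) i + Finsupp.single (1 : Fin 2) i) f

/-- `Diag F`, as an element of `K[[t]]`. -/
def Diag {K : Type*} [Field K] (F : RatFunc₂ K) : PowerSeries K :=
  diagSeries (expansion F)

/-- The value `p(t / y, y)` in `K(t)(y)` of a polynomial `p(x, y)`. -/
def substPoly {K : Type*} [Field K] (p : MvPolynomial (Fin 2) K) : RatFunc (RatFunc K) :=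
  MvPolynomial.eval₂ (RatFunc.C.comp RatFunc.C)
    ![RatFunc.C (RatFunc.X : RatFunc K) / RatFunc.X, RatFunc.X] p

/-- The rational function `G(t, y) = (1 / y) F(t / y, y)`, in `K(t)(y)`. -/
def G {K : Type*} [Field K] (F : RatFunc₂ K) : RatFunc (RatFunc K) :=
  1 / RatFunc.X * (substPoly (numer F) / substPoly (denom F))

/-! ### Series in fractional powers of `t`

`HahnSeries ℚ Kbar` is the field of series in `t` with coefficients in `Kbar`, exponents in `ℚ`
and well-ordered support. The field `Kbar((t^{1/N}))` is its subfield of the series whose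
exponents all lie in `(1/N) ℤ`, and the `t`-adic valuation is `HahnSeries.orderTop`
(with value `⊤` at `0`). -/

/-- Membership in `Kbar((t^{1/N}))`. -/
def IsLaurentInRoot {Kbar : Type*} [Field Kbar] (N : ℕ) (a : HahnSeries ℚ Kbar) : Prop :=
  ∀ q ∈ a.support, ∃ m : ℤ, q = (m : ℚ) / (N : ℚ)

section Embeddings

variable (K Kbar : Type*) [Field K] [Field Kbar] [Algebra K Kbar]

/-- The embedding `∑ a_i t^i ↦ ∑ a_i t^i` of `K[[t]]` into the series with rational exponents. -/
def embSeries : PowerSeries K →+* HahnSeries ℚ Kbar :=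
  (HahnSeries.ofPowerSeries ℚ Kbar).comp (PowerSeries.map (algebraMap K Kbar))

theorem embSeries_injective : Function.Injective (embSeries K Kbar) := by
  intro f g h
  have h' := HahnSeries.ofPowerSeries_injective (Γ := ℚ) (R := Kbar) h
  exact PowerSeries.map_injective _ (algebraMap K Kbar).injective h'

/-- The embedding of `K[t]`. -/
def embPoly : K[X] →+* HahnSeries ℚ Kbar :=
  (embSeries K Kbar).comp Polynomial.coeToPowerSeries.ringHom

theorem embPoly_injective : Function.Injective (embPoly K Kbar) :=
  (embSeries_injective K Kbar).comp (Polynomial.coe_injective K)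

/-- The embedding of `K(t)` that sends `t` to `t`. -/
def embRat : RatFunc K →+* HahnSeries ℚ Kbar :=
  IsFractionRing.lift (A := K[X]) (embPoly_injective K Kbar)

end Embeddings

/-! ### Poles and residues -/

section Residues

variable {k L : Type*} [Field k] [Field L]

open Classical in
/-- The set of poles, in an extension `ι : k → L`, of a rational function `g` in `k(y)`:
the roots of its denominator in lowest terms. -/
def poles (ι : k →+* L) (g : RatFunc k) : Finset L :=
  (g.denom.map ι).roots.toFinset

/-- The residue of `g` at `y = a`: the coefficient of `z ^ (-1)` in the Laurent expansion of
`g (a + z)` at `z = 0`. Here `taylor a p` is the polynomial `p (a + z)`. -/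
def residue (ι : k →+* L) (g : RatFunc k) (a : L) : L :=
  (((taylor a (g.num.map ι) : L[X]) : PowerSeries L) /
    ((taylor a (g.denom.map ι) : L[X]) : PowerSeries L) : LaurentSeries L).coeff (-1)

end Residues

open Classical in
/-- The small branches: the poles of `(1 / y) F(t / y, y)` of positive `t`-adic valuation. -/
def smallBranches {K : Type*} (Kbar : Type*) [Field K] [Field Kbar] [Algebra K Kbar]
    (F : RatFunc₂ K) : Finset (HahnSeries ℚ Kbar) :=
  (poles (embRat K Kbar) (G F)).filter fun a => 0 < a.orderTop

end DiagonalResidues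

end

/-! Write k for `Kbar`. Both sides are computed in one field, the Hahn series in t with coefficients
in k((y)), which contains K(t)(y) (`embBivariate`). Expanding there amounts to treating t as
infinitely small compared with y.

The image of G is y⁻¹ F(t/y, y) = ∑ a_{i,j} t^i y^{j-i-1} (`embBivariate_G`), so its coefficient of
y⁻¹ is the diagonal (`resY_inv_yVar_mul_expandY`).

The functional "coefficient of y⁻¹" is linear over k((t^ℚ)), so it can be read off a partial
fraction decomposition of G in y. The polynomial part gives 0. If a has positive valuation, 1/(y -
a)^m expands in powers of a/y and gives 1 for m = 1 and 0 otherwise (`resY_inv_pow_of_pos`). If a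
does not have positive valuation, the expansion has no negative powers of y and gives 0
(`resY_inv_pow_of_not_pos`). What remains is the sum of the coefficients of 1/(y - a) at the small
poles, that is, of the residues there (`resY_evalY_div`).

The poles are Puiseux series by the Newton–Puiseux theorem (`isAlgClosed_puiseux`). A monic
polynomial of degree n ≥ 2 is translated to kill its subleading coefficient. Unless this gives X^n,
its roots are scaled along the Newton polygon so that the coefficients are integral and the
reduction is not X^n. This reduction is not an n-th power of a linear factor, so Weierstrass
factorization at one of its roots yields a proper factor. -/

noncomputable section

namespace DiagonalResidues

open Polynomial

/-! ### Factoring polynomials over k[[s]] by Weierstrass preparation -/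

section Weierstrass

/-- A polynomial over a complete local ring, nonzero modulo the maximal ideal, is divisible by
a distinguished polynomial whose degree is the order of its reduction. -/
theorem exists_isDistinguishedAt_dvd {A : Type*} [CommRing A] [IsLocalRing A]
    [IsAdicComplete (IsLocalRing.maximalIdeal A) A] (Q : A[X])
    (hQ : (Q : PowerSeries A).map (IsLocalRing.residue A) ≠ 0) :
    ∃ g : A[X], g.Monic ∧ g ∣ Q ∧
      g.natDegree = ((Q : PowerSeries A).map (IsLocalRing.residue A)).order.toNat := by
  obtain ⟨g, h, H⟩ := PowerSeries.exists_isWeierstrassFactorization hQ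
  have hg := H.isDistinguishedAt
  have hdeg : g.natDegree = ((g : PowerSeries A).map
      (Ideal.Quotient.mk (IsLocalRing.maximalIdeal A))).order.toNat := by
    have h1 := hg.coe_natDegree_eq_order_map (g : PowerSeries A) 1
      (by rw [map_one, ← Ideal.ne_top_iff_one]; exact Ideal.IsMaximal.ne_top inferInstance)
      (by rw [mul_one])
    rw [← h1, ENat.toNat_natCast]
  refine ⟨g, hg.monic, ?_, H.natDegree_eq_toNat_order_map⟩
  rw [← modByMonic_eq_zero_iff_dvd hg.monic]
  -- Compare Q = g h with the polynomial division of Q by g: uniqueness of Weierstrass division by g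
  -- forces the remainder to vanish.
  have key : (g : PowerSeries A) * (h - (Q /ₘ g : A[X])) = ((Q %ₘ g : A[X]) : PowerSeries A) := by
    have h1 : ((Q %ₘ g : A[X]) : PowerSeries A) + g * (Q /ₘ g : A[X]) = Q := by
      rw [← Polynomial.coe_mul, ← Polynomial.coe_add, modByMonic_add_div]
    rw [mul_sub, ← H.eq_mul, ← h1, add_sub_cancel_right]
  refine ((hg.isWeierstrassDivisorAt' ).eq_zero_of_mul_eq ?_ key).2
  rw [← hdeg, ← degree_eq_natDegree hg.monic.ne_zero]
  exact degree_modByMonic_lt _ hg.monic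

instance {k : Type*} [Field k] : IsAdicComplete (IsLocalRing.maximalIdeal (PowerSeries k))
    (PowerSeries k) := by
  rw [PowerSeries.maximalIdeal_eq_span_X]
  infer_instance

theorem residue_eq_zero_iff_constantCoeff {k : Type*} [Field k] (a : PowerSeries k) :
    IsLocalRing.residue (PowerSeries k) a = 0 ↔ PowerSeries.constantCoeff a = 0 := by
  rw [IsLocalRing.residue_eq_zero_iff, ← PowerSeries.ker_coeff_eq_max_ideal, RingHom.mem_ker]

/-- A monic polynomial over `k[[s]]` without subleading term whose reduction is not a power of
`X` has a proper monic factor. -/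
theorem exists_monic_dvd_of_map_ne_X_pow {k : Type*} [Field k] [CharZero k] [IsAlgClosed k]
    {Q : (PowerSeries k)[X]} (hQ : Q.Monic) (hn : 0 < Q.natDegree)
    (hsub : Q.coeff (Q.natDegree - 1) = 0)
    (hne : Q.map PowerSeries.constantCoeff ≠ X ^ Q.natDegree) :
    ∃ g : (PowerSeries k)[X], g.Monic ∧ g ∣ Q ∧ 0 < g.natDegree ∧ g.natDegree < Q.natDegree := by
  set n := Q.natDegree with hn_def
  set q := Q.map (PowerSeries.constantCoeff (R := k)) with hq
  have hqm : q.Monic := hQ.map _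
  have hqn : q.natDegree = n := hQ.natDegree_map _
  obtain ⟨α, hα⟩ := IsAlgClosed.exists_root q
    (by rw [degree_eq_natDegree hqm.ne_zero, hqn]; exact_mod_cast hn.ne')
  set Q' := taylor (PowerSeries.C α) Q with hQ'
  have hmap : Q'.map PowerSeries.constantCoeff = taylor α q := by
    rw [hQ', Polynomial.map_taylor, PowerSeries.constantCoeff_C]
  have hcoeff (i : ℕ) : PowerSeries.constantCoeff (Q'.coeff i) = (taylor α q).coeff i := by
    rw [← hmap, coeff_map]
  -- The reduction q is not (X - α)^n: otherwise its subleading coefficient -nα would vanish, so α =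
  -- 0 in characteristic 0 and q = X^n. Hence the multiplicity of the root α lies strictly between 0
  -- and n.
  obtain ⟨i, hin, hi⟩ : ∃ i < n, (taylor α q).coeff i ≠ 0 := by
    by_contra! hall
    have hX : taylor α q = X ^ n := by
      ext i
      rcases lt_trichotomy i n with h | h | h
      · rw [hall i h, coeff_X_pow, if_neg h.ne]
      · rw [h, ← hqn, coeff_taylor_natDegree, hqm.leadingCoeff, coeff_X_pow, if_pos rfl]
      · rw [coeff_eq_zero_of_natDegree_lt (by rwa [natDegree_taylor, hqn]), coeff_X_pow,
          if_neg h.ne']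
    have hq2 : q = (X + C (-α)) ^ n := by
      rw [← taylor_X_pow, ← hX, taylor_taylor, neg_add_cancel, taylor_zero]
    have h0 : q.coeff (n - 1) = 0 := by rw [hq, coeff_map, hsub, map_zero]
    rw [hq2, coeff_X_add_C_pow, Nat.sub_sub_self hn, pow_one] at h0
    have hch : ((n.choose (n - 1) : ℕ) : k) ≠ 0 :=
      Nat.cast_ne_zero.2 (Nat.choose_pos (Nat.sub_le _ _)).ne'
    have hα0 : -α = 0 := by simpa [hch] using h0
    apply hne
    rw [hq2, hα0, C_0, add_zero]
  have hres (j : ℕ) : PowerSeries.coeff j ((Q' : PowerSeries (PowerSeries k)).map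
      (IsLocalRing.residue (PowerSeries k))) = 0 ↔ (taylor α q).coeff j = 0 := by
    rw [PowerSeries.coeff_map, Polynomial.coeff_coe, residue_eq_zero_iff_constantCoeff, hcoeff]
  have hne0 : (Q' : PowerSeries (PowerSeries k)).map
      (IsLocalRing.residue (PowerSeries k)) ≠ 0 := fun h => hi ((hres i).1 (by rw [h, map_zero]))
  obtain ⟨g, hgm, hgd, hgn⟩ := exists_isDistinguishedAt_dvd Q' hne0
  set o := ((Q' : PowerSeries (PowerSeries k)).map (IsLocalRing.residue (PowerSeries k))).order
    with ho
  have hle : g.natDegree < n := by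
    rw [hgn]
    refine lt_of_le_of_lt (ENat.toNat_le_of_le_natCast ?_) hin
    exact PowerSeries.order_le _ (fun h => hi ((hres i).1 h))
  have hpos : 0 < g.natDegree := by
    rw [hgn, Nat.pos_iff_ne_zero]
    intro h
    have h2 := PowerSeries.coeff_order hne0
    rw [← ho, h] at h2
    exact h2 ((hres 0).2 (by rw [taylor_coeff_zero]; exact hα))
  refine ⟨taylor (-PowerSeries.C α) g, ?_, ?_, by rwa [natDegree_taylor],
    by rwa [natDegree_taylor]⟩
  · rw [Monic, leadingCoeff_taylor, hgm]
  · obtain ⟨r, hr⟩ := hgd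
    refine ⟨taylor (-PowerSeries.C α) r, ?_⟩
    rw [← taylor_mul, ← hr, hQ', taylor_taylor, neg_add_cancel, taylor_zero]

end Weierstrass

/-! ### Puiseux series and the Newton–Puiseux theorem -/

section Puiseux

variable (k : Type*) [Field k]

/-- The inclusion `ℤ → ℚ`, `m ↦ m / N`. -/
def divHom (N : ℕ+) : ℤ →+ ℚ :=
  AddMonoidHom.mk' (fun m => (m : ℚ) / (N : ℕ)) fun a b => by push_cast; ring

@[simp]
theorem divHom_apply (N : ℕ+) (m : ℤ) : divHom N m = (m : ℚ) / (N : ℕ) := rfl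

theorem divHom_le_iff (N : ℕ+) (a b : ℤ) : divHom N a ≤ divHom N b ↔ a ≤ b := by
  have : (0 : ℚ) < (N : ℕ) := by exact_mod_cast N.pos
  rw [divHom_apply, divHom_apply, div_le_div_iff_of_pos_right this, Int.cast_le]

theorem divHom_injective (N : ℕ+) : Function.Injective (divHom N) := fun a b h =>
  le_antisymm ((divHom_le_iff N a b).1 h.le) ((divHom_le_iff N b a).1 h.ge)

/-- The embedding `k((s)) → k((t^ℚ))`, `s ↦ t^{1/N}`. -/
def rootEmb (N : ℕ+) : LaurentSeries k →+* HahnSeries ℚ k :=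
  HahnSeries.embDomainRingHom (divHom N) (divHom_injective N) (divHom_le_iff N)

variable {k}

theorem rootEmb_coeff (N : ℕ+) (b : LaurentSeries k) (m : ℤ) :
    (rootEmb k N b).coeff ((m : ℚ) / (N : ℕ)) = b.coeff m :=
  HahnSeries.embDomain_coeff (f := ⟨⟨divHom N, divHom_injective N⟩, divHom_le_iff N _ _⟩)

theorem isLaurentInRoot_rootEmb (N : ℕ+) (b : LaurentSeries k) :
    IsLaurentInRoot N (rootEmb k N b) := by
  intro q hq
  obtain ⟨m, -, rfl⟩ := HahnSeries.support_embDomain_subset hq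
  exact ⟨m, rfl⟩

theorem exists_rootEmb_eq {N : ℕ+} {a : HahnSeries ℚ k} (h : IsLaurentInRoot N a) :
    ∃ b, rootEmb k N b = a := by
  have hN : (0 : ℚ) < (N : ℕ) := by exact_mod_cast N.pos
  refine ⟨⟨fun m => a.coeff ((m : ℚ) / (N : ℕ)), ?_⟩, ?_⟩
  -- The monotone map q ↦ ⌊qN⌋ sends m/N to m and carries the partial well-order of the support to
  -- ℤ.
  · refine (a.isPWO_support.image_of_monotone (f := fun q : ℚ => ⌊q * (N : ℕ)⌋) ?_).mono ?_
    · intro x y hxy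
      exact Int.floor_mono (mul_le_mul_of_nonneg_right hxy hN.le)
    · intro m hm
      refine ⟨(m : ℚ) / (N : ℕ), hm, ?_⟩
      simp only [div_mul_cancel₀ _ hN.ne', Int.floor_intCast]
  · ext q
    by_cases hq : ∃ m : ℤ, q = (m : ℚ) / (N : ℕ)
    · obtain ⟨m, rfl⟩ := hq
      rw [rootEmb_coeff]
    · have h1 : q ∉ a.support := fun hs => hq (h q hs)
      have h2 := fun b hs => hq (isLaurentInRoot_rootEmb (k := k) N b q hs)
      rw [HahnSeries.mem_support, not_not] at h1
      rw [h1]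
      by_contra h3
      exact h2 _ h3

theorem isLaurentInRoot_iff {N : ℕ+} {a : HahnSeries ℚ k} :
    IsLaurentInRoot N a ↔ a ∈ (rootEmb k N).fieldRange := by
  rw [RingHom.mem_fieldRange]
  exact ⟨exists_rootEmb_eq, by rintro ⟨b, rfl⟩; exact isLaurentInRoot_rootEmb N b⟩

theorem IsLaurentInRoot.of_dvd {N M : ℕ} {a : HahnSeries ℚ k} (h : IsLaurentInRoot N a)
    (hd : N ∣ M) (hM : 0 < M) : IsLaurentInRoot M a := by
  obtain ⟨c, rfl⟩ := hd
  intro q hq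
  obtain ⟨m, rfl⟩ := h q hq
  have hN : (N : ℚ) ≠ 0 := by
    rintro h0; rw [Nat.cast_eq_zero] at h0; simp [h0] at hM
  have hc : (c : ℚ) ≠ 0 := by
    rintro h0; rw [Nat.cast_eq_zero] at h0; simp [h0] at hM
  refine ⟨m * c, ?_⟩
  push_cast
  field_simp

variable (k) in
/-- The field of Puiseux series, as a subfield of the field of Hahn series. -/
def puiseux : Subfield (HahnSeries ℚ k) where
  carrier := {a | ∃ N : ℕ+, a ∈ (rootEmb k N).fieldRange}
  mul_mem' := by
    rintro a b ⟨N, ha⟩ ⟨M, hb⟩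
    rw [← isLaurentInRoot_iff] at ha hb
    refine ⟨N * M, mul_mem (isLaurentInRoot_iff.1 ?_) (isLaurentInRoot_iff.1 ?_)⟩
    · exact ha.of_dvd (by simp) (N * M).pos
    · exact hb.of_dvd (by simp) (N * M).pos
  add_mem' := by
    rintro a b ⟨N, ha⟩ ⟨M, hb⟩
    rw [← isLaurentInRoot_iff] at ha hb
    refine ⟨N * M, add_mem (isLaurentInRoot_iff.1 ?_) (isLaurentInRoot_iff.1 ?_)⟩
    · exact ha.of_dvd (by simp) (N * M).pos
    · exact hb.of_dvd (by simp) (N * M).pos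
  one_mem' := ⟨1, one_mem _⟩
  zero_mem' := ⟨1, zero_mem _⟩
  neg_mem' := by
    rintro a ⟨N, ha⟩
    exact ⟨N, neg_mem ha⟩
  inv_mem' := by
    rintro a ⟨N, ha⟩
    exact ⟨N, inv_mem ha⟩

theorem mem_puiseux {a : HahnSeries ℚ k} : a ∈ puiseux k ↔ ∃ N : ℕ+, IsLaurentInRoot N a :=
  exists_congr fun _ => isLaurentInRoot_iff.symm

theorem single_mem_puiseux (q : ℚ) (c : k) : HahnSeries.single q c ∈ puiseux k := by
  rw [mem_puiseux]
  refine ⟨⟨q.den, q.den_pos⟩, fun r hr => ⟨q.num, ?_⟩⟩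
  rw [HahnSeries.eq_of_mem_support_single hr]
  exact (Rat.num_div_den q).symm

/-- The embedding `k[[s]] → k((t^ℚ))`, `s ↦ t^{1/N}`, with values in the Puiseux series. -/
def rootEmbSeries (N : ℕ+) : PowerSeries k →+* puiseux k :=
  ((rootEmb k N).comp (HahnSeries.ofPowerSeries ℤ k)).codRestrict (puiseux k)
    fun _ => ⟨N, _, rfl⟩

theorem rootEmbSeries_injective (N : ℕ+) : Function.Injective (rootEmbSeries (k := k) N) := by
  intro f g h
  exact HahnSeries.ofPowerSeries_injective ((rootEmb k N).injective congr(($h).1))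

theorem rootEmbSeries_coeff_zero (N : ℕ+) (f : PowerSeries k) :
    (rootEmbSeries N f : HahnSeries ℚ k).coeff 0 = PowerSeries.constantCoeff f := by
  have h := rootEmb_coeff N (HahnSeries.ofPowerSeries ℤ k f) 0
  rw [Int.cast_zero, zero_div] at h
  refine h.trans ?_
  rw [← PowerSeries.coeff_zero_eq_constantCoeff_apply]
  exact_mod_cast HahnSeries.ofPowerSeries_apply_coeff (Γ := ℤ) f 0

theorem exists_rootEmbSeries_eq {N : ℕ+} {a : puiseux k}
    (h : IsLaurentInRoot N (a : HahnSeries ℚ k))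
    (h0 : ∀ q < 0, (a : HahnSeries ℚ k).coeff q = 0) : ∃ f, rootEmbSeries N f = a := by
  obtain ⟨b, hb⟩ := exists_rootEmb_eq h
  refine ⟨PowerSeries.mk fun n => b.coeff n, Subtype.ext ?_⟩
  rw [← hb]
  change rootEmb k N (HahnSeries.ofPowerSeries ℤ k _) = _
  congr 1
  ext m
  obtain ⟨n, rfl | rfl⟩ := m.eq_nat_or_neg
  · exact (HahnSeries.ofPowerSeries_apply_coeff (Γ := ℤ) _ n).trans (PowerSeries.coeff_mk _ _)
  · rcases Nat.eq_zero_or_pos n with rfl | hn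
    · exact (HahnSeries.ofPowerSeries_apply_coeff (Γ := ℤ) _ 0).trans (PowerSeries.coeff_mk _ _)
    · have h1 : b.coeff (-(n : ℤ)) = 0 := by
        rw [← rootEmb_coeff N, hb]
        apply h0
        apply div_neg_of_neg_of_pos
        · push_cast; simpa using hn
        · exact_mod_cast N.pos
      rw [h1]
      have := PowerSeries.coeff_coe (PowerSeries.mk fun n => b.coeff n) (-(n : ℤ))
      rw [if_pos (by omega)] at this
      exact this

/-- Scaling the roots makes the coefficients of a polynomial over the Puiseux series integral
and not all small. -/
theorem exists_scaleRoots_eq_map {p : (puiseux k)[X]} (hp : p.Monic)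
    (hne : p ≠ X ^ p.natDegree) :
    ∃ (s : puiseux k) (N : ℕ+) (Q : (PowerSeries k)[X]), s ≠ 0 ∧
      Q.map (rootEmbSeries N) = p.scaleRoots s ∧
      Q.map PowerSeries.constantCoeff ≠ X ^ p.natDegree := by
  classical
  set n := p.natDegree with hn
  let S := (Finset.range n).filter fun i => p.coeff i ≠ 0
  -- Newton polygon slopes. With v the least slope and s = t^(-v), scaling the roots by s gives the
  -- i-th coefficient order ord(p_i) - (n - i)v ≥ 0, with equality at the minimizing index.
  let w : ℕ → ℚ := fun i => (p.coeff i : HahnSeries ℚ k).order / ((n - i : ℕ) : ℚ)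
  have hS : S.Nonempty := by
    by_contra hS
    rw [Finset.not_nonempty_iff_eq_empty, Finset.filter_eq_empty_iff] at hS
    apply hne
    ext i
    rcases lt_trichotomy i n with h | h | h
    · rw [not_not.1 (hS (Finset.mem_range.2 h)), coeff_X_pow, if_neg h.ne]
    · rw [h, hn, hp.coeff_natDegree, coeff_X_pow, if_pos rfl]
    · rw [coeff_eq_zero_of_natDegree_lt h, coeff_X_pow, if_neg h.ne']
  obtain ⟨i₀, hi₀, hmin⟩ := Finset.exists_min_image S w hS
  rw [Finset.mem_filter, Finset.mem_range] at hi₀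
  set v := w i₀ with hv
  let s : puiseux k := ⟨HahnSeries.single (-v) 1, single_mem_puiseux _ _⟩
  have hs : s ≠ 0 := fun h => by
    have : HahnSeries.single (-v) (1 : k) = 0 := congr(($h).1)
    exact one_ne_zero (HahnSeries.single_eq_zero_iff.1 this)
  have hcoeff (i : ℕ) (q : ℚ) : ((p.scaleRoots s).coeff i : HahnSeries ℚ k).coeff q =
      (p.coeff i : HahnSeries ℚ k).coeff (q + ((n - i : ℕ) : ℚ) * v) := by
    rw [coeff_scaleRoots]
    change ((p.coeff i : HahnSeries ℚ k) * (HahnSeries.single (-v) (1 : k)) ^ (n - i)).coeff q = _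
    rw [HahnSeries.single_pow, one_pow, HahnSeries.coeff_mul_single, mul_one, nsmul_eq_mul]
    congr 1
    ring
  have hneg (i : ℕ) (q : ℚ) (hq : q < 0) :
      ((p.scaleRoots s).coeff i : HahnSeries ℚ k).coeff q = 0 := by
    rw [hcoeff]
    by_cases h0 : p.coeff i = 0
    · simp [h0]
    rcases lt_trichotomy i n with h | h | h
    · apply HahnSeries.coeff_eq_zero_of_lt_order
      have h1 := hmin i (by simp [S, h, h0])
      have h2 : (0 : ℚ) < ((n - i : ℕ) : ℚ) := by exact_mod_cast Nat.sub_pos_of_lt h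
      rw [le_div_iff₀ h2] at h1
      linarith
    · rw [h, hn, hp.coeff_natDegree]
      simp only [Nat.sub_self, Nat.cast_zero, zero_mul, add_zero, OneMemClass.coe_one,
        HahnSeries.coeff_one]
      rw [if_neg hq.ne]
    · exact absurd (coeff_eq_zero_of_natDegree_lt h) h0
  have hN (i : ℕ) := mem_puiseux.1 ((p.scaleRoots s).coeff i).2
  choose N hN using hN
  let M : ℕ+ := ∏ i ∈ Finset.range (n + 1), N i
  have hM (i : ℕ) : IsLaurentInRoot M ((p.scaleRoots s).coeff i : HahnSeries ℚ k) := by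
    rcases lt_or_ge i (n + 1) with h | h
    · refine (hN i).of_dvd ?_ M.pos
      rw [← PNat.dvd_iff]
      exact Finset.dvd_prod_of_mem _ (Finset.mem_range.2 h)
    · rw [coeff_eq_zero_of_natDegree_lt (by rw [natDegree_scaleRoots]; omega)]
      intro q hq
      simp at hq
  have hl : p.scaleRoots s ∈ lifts (rootEmbSeries (k := k) M) := by
    rw [lifts_iff_coeff_lifts]
    intro i
    exact exists_rootEmbSeries_eq (hM i) (hneg i)
  obtain ⟨Q, hQ⟩ := (mem_lifts _).1 hl
  refine ⟨s, M, Q, hs, hQ, fun hX => ?_⟩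
  have h1 : PowerSeries.constantCoeff (Q.coeff i₀) = 0 := by
    rw [← coeff_map, hX, coeff_X_pow, if_neg hi₀.1.ne]
  rw [← rootEmbSeries_coeff_zero M, ← coeff_map, hQ, hcoeff] at h1
  have h2 : (0 : ℚ) < ((n - i₀ : ℕ) : ℚ) := by exact_mod_cast Nat.sub_pos_of_lt hi₀.1
  rw [zero_add, hv, mul_div_cancel₀ _ h2.ne', HahnSeries.coeff_order_eq_zero] at h1
  exact hi₀.2 (Subtype.ext h1)

theorem coeff_taylor_natDegree_sub_one {R : Type*} [CommRing R] {p : R[X]} (hp : p.Monic)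
    (hn : 0 < p.natDegree) (r : R) :
    (taylor r p).coeff (p.natDegree - 1) = p.coeff (p.natDegree - 1) + p.natDegree * r := by
  have h1 : (hasseDeriv (p.natDegree - 1) p).natDegree < 2 := by
    refine (natDegree_hasseDeriv_le _ _).trans_lt ?_
    omega
  have h2 : 1 + (p.natDegree - 1) = p.natDegree := by omega
  rw [taylor_coeff, eval_eq_sum_range' h1, Finset.sum_range_succ, Finset.sum_range_one,
    hasseDeriv_coeff, hasseDeriv_coeff, zero_add, h2, hp.coeff_natDegree, Nat.choose_self,
    Nat.choose_symm (show 1 ≤ p.natDegree by omega), Nat.choose_one_right]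
  simp

/-- Translating and scaling the roots are invertible and preserve degrees and divisibility, so a
proper factor over k[[s]] of the normalized polynomial can be carried back to p. -/
theorem exists_dvd_natDegree_lt [CharZero k] [IsAlgClosed k] {p : (puiseux k)[X]} (hp : p.Monic)
    (hn : 2 ≤ p.natDegree) : ∃ g, g ∣ p ∧ 0 < g.natDegree ∧ g.natDegree < p.natDegree := by
  have hchar : CharZero (puiseux k) :=
    charZero_of_injective_ringHom
      (f := (rootEmbSeries (k := k) 1).comp PowerSeries.C)
      ((rootEmbSeries_injective 1).comp PowerSeries.C_injective)
  set n := p.natDegree with hn_def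
  -- Translation by c adds nc to the subleading coefficient, so this choice kills it; dividing by n
  -- uses characteristic 0.
  set c := -(p.coeff (n - 1) / n) with hc
  set p₁ := taylor c p with hp₁
  have hp₁m : p₁.Monic := by rw [Monic, leadingCoeff_taylor, hp]
  have hp₁n : p₁.natDegree = n := natDegree_taylor _ _
  have hsub : p₁.coeff (n - 1) = 0 := by
    have hn0 : (n : puiseux k) ≠ 0 := by simp; omega
    rw [hp₁, hn_def, coeff_taylor_natDegree_sub_one hp (by omega), ← hn_def, hc]
    field_simp
    ring
  suffices h : ∃ g, g ∣ p₁ ∧ 0 < g.natDegree ∧ g.natDegree < n by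
    obtain ⟨g, ⟨r, hr⟩, h1, h2⟩ := h
    refine ⟨taylor (-c) g, ⟨taylor (-c) r, ?_⟩, by rwa [natDegree_taylor],
      by rwa [natDegree_taylor]⟩
    rw [← taylor_mul, ← hr, hp₁, taylor_taylor, neg_add_cancel, taylor_zero]
  by_cases hX : p₁ = X ^ p₁.natDegree
  · refine ⟨X, ?_, by simp, by rw [natDegree_X]; omega⟩
    rw [hX]
    exact dvd_pow_self _ (by omega)
  obtain ⟨s, N, Q, hs, hQ, hQne⟩ := exists_scaleRoots_eq_map hp₁m hX
  have hinj := rootEmbSeries_injective (k := k) N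
  have hQn : Q.natDegree = n := by
    rw [← natDegree_map_eq_of_injective hinj, hQ, natDegree_scaleRoots, hp₁n]
  have hQm : Q.Monic := by
    rw [hinj.monic_map_iff, hQ, monic_scaleRoots_iff]
    exact hp₁m
  obtain ⟨g, hgm, ⟨r, hr⟩, hg0, hgn⟩ := exists_monic_dvd_of_map_ne_X_pow hQm (by omega)
    (by
      rw [hQn]
      apply hinj
      rw [map_zero, ← coeff_map, hQ, coeff_scaleRoots, hsub, zero_mul])
    (by rwa [hQn, ← hp₁n])
  refine ⟨(g.map (rootEmbSeries N)).scaleRoots s⁻¹, ?_, ?_, ?_⟩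
  · have : p₁ = (p₁.scaleRoots s).scaleRoots s⁻¹ := by
      rw [← scaleRoots_mul, mul_inv_cancel₀ hs, scaleRoots_one]
    rw [this, ← hQ, hr, Polynomial.map_mul]
    exact scaleRoots_dvd _ _ (dvd_mul_right _ _)
  · rwa [natDegree_scaleRoots, natDegree_map_eq_of_injective hinj]
  · rwa [natDegree_scaleRoots, natDegree_map_eq_of_injective hinj, ← hQn]

/-- **Newton–Puiseux theorem.** -/
theorem isAlgClosed_puiseux [CharZero k] [IsAlgClosed k] : IsAlgClosed (puiseux k) := by
  refine IsAlgClosed.of_exists_root _ fun p hp hirr => ?_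
  have hpos := hirr.natDegree_pos
  rcases Nat.lt_or_ge p.natDegree 2 with h | h
  · exact exists_root_of_degree_eq_one
      (by rw [degree_eq_natDegree hp.ne_zero]; exact_mod_cast (by omega : p.natDegree = 1))
  · obtain ⟨g, ⟨r, hr⟩, h1, h2⟩ := exists_dvd_natDegree_lt hp h
    exfalso
    have hne : g * r ≠ 0 := hr ▸ hp.ne_zero
    have hd : p.natDegree = g.natDegree + r.natDegree := by
      rw [hr, natDegree_mul (left_ne_zero_of_mul hne) (right_ne_zero_of_mul hne)]
    rcases hirr.isUnit_or_isUnit hr with hu | hu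
    · have := natDegree_eq_zero_of_isUnit hu
      omega
    · have := natDegree_eq_zero_of_isUnit hu
      omega

/-- A polynomial whose coefficients are Puiseux series splits. -/
theorem splits_of_coeff_mem_puiseux [CharZero k] [IsAlgClosed k] {f : (HahnSeries ℚ k)[X]} (hf : ∀ i, f.coeff i ∈ puiseux k) :
    f.Splits ∧ ∀ a ∈ f.roots, a ∈ puiseux k := by
  have := isAlgClosed_puiseux (k := k)
  obtain ⟨p, rfl⟩ := (mem_lifts (f := (puiseux k).subtype) f).1
    ((lifts_iff_coeff_lifts f).2 fun i => ⟨⟨_, hf i⟩, rfl⟩)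
  have hs := IsAlgClosed.splits p
  refine ⟨hs.map _, fun a ha => ?_⟩
  rw [hs.roots_map, Multiset.mem_map] at ha
  obtain ⟨b, -, rfl⟩ := ha
  exact b.2

theorem exists_pos_forall_isLaurentInRoot (s : Finset (HahnSeries ℚ k))
    (hs : ∀ a ∈ s, a ∈ puiseux k) : ∃ N : ℕ, 0 < N ∧ ∀ a ∈ s, IsLaurentInRoot N a := by
  choose! N hN using fun a ha => mem_puiseux.1 (hs a ha)
  refine ⟨(∏ a ∈ s, N a : ℕ+), PNat.pos _, fun a ha => (hN a ha).of_dvd ?_ (PNat.pos _)⟩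
  rw [← PNat.dvd_iff]
  exact Finset.dvd_prod_of_mem _ ha

end Puiseux

/-! ### Elements of K(t) as Puiseux series -/

section Embedding

variable (K Kbar : Type*) [Field K] [Field Kbar] [Algebra K Kbar]

theorem embPoly_mem_puiseux (p : K[X]) : embPoly K Kbar p ∈ puiseux Kbar := by
  rw [mem_puiseux]
  refine ⟨1, fun q hq => ?_⟩
  obtain ⟨m, -, rfl⟩ := HahnSeries.support_embDomain_subset hq
  exact ⟨m, by simp⟩

theorem embRat_mem_puiseux (r : RatFunc K) : embRat K Kbar r ∈ puiseux Kbar := by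
  rw [← RatFunc.num_div_denom r, map_div₀, embRat, IsFractionRing.lift_algebraMap,
    IsFractionRing.lift_algebraMap]
  exact div_mem (embPoly_mem_puiseux K Kbar _) (embPoly_mem_puiseux K Kbar _)

end Embedding

/-! ### Change of coefficients in Hahn series -/

section MapHom

/-- The ring homomorphism of Hahn series that applies `f` to the coefficients. -/
def mapHom {R S : Type*} [CommRing R] [CommRing S] (f : R →+* S) :
    HahnSeries ℚ R →+* HahnSeries ℚ S where
  toFun x := x.map f
  map_one' := HahnSeries.map_one f.toMonoidWithZeroHom
  map_mul' _ _ := HahnSeries.map_mul (f : R →ₙ+* S)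
  map_zero' := by ext; simp
  map_add' _ _ := HahnSeries.map_add (f : R →+ S)

variable {R S T : Type*} [CommRing R] [CommRing S] [CommRing T]

@[simp]
theorem mapHom_coeff (f : R →+* S) (x : HahnSeries ℚ R) (q : ℚ) :
    (mapHom f x).coeff q = f (x.coeff q) := rfl

theorem mapHom_mapHom (f : R →+* S) (g : S →+* T) (x : HahnSeries ℚ R) :
    mapHom g (mapHom f x) = mapHom (g.comp f) x := rfl

theorem mapHom_C (f : R →+* S) (r : R) : mapHom f (HahnSeries.C r) = HahnSeries.C (f r) :=
  HahnSeries.map_C r f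

end MapHom

/-! ### The coefficient of y⁻¹ and the powers of 1/(y - a) -/

section Functional

variable {k : Type*} [Field k]

theorem coeff_neg_one_ofPowerSeries {R : Type*} [CommRing R] (f : PowerSeries R) :
    (HahnSeries.ofPowerSeries ℤ R f).coeff (-1) = 0 := by
  have := PowerSeries.coeff_coe f (-1)
  rwa [if_pos (by norm_num)] at this

variable (k) in
/-- The series in `t` with constant coefficients among the series in `t` with coefficients
in `k((y))`. -/
def constEmb : HahnSeries ℚ k →+* HahnSeries ℚ (LaurentSeries k) :=
  mapHom HahnSeries.C

variable (k) in
/-- The element `y` of `k((y))((t^ℚ))`. -/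
def yVar : HahnSeries ℚ (LaurentSeries k) :=
  HahnSeries.C (HahnSeries.single 1 1)

theorem inv_yVar : (yVar k)⁻¹ = HahnSeries.C (HahnSeries.single (-1) 1) := by
  apply inv_eq_of_mul_eq_one_right
  rw [yVar, ← map_mul, HahnSeries.single_mul_single]
  simp

variable (k) in
/-- The coefficient of `y^{-1}`, as a series in `t`. -/
def resY : HahnSeries ℚ (LaurentSeries k) →+ HahnSeries ℚ k where
  toFun x := x.map (HahnSeries.coeff.addMonoidHom (-1) : LaurentSeries k →+ k)
  map_zero' := by ext; simp
  map_add' _ _ := HahnSeries.map_add _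

theorem resY_coeff (x : HahnSeries ℚ (LaurentSeries k)) (q : ℚ) :
    (resY k x).coeff q = (x.coeff q).coeff (-1) := rfl

/-- Multiplying by a scalar from k commutes with taking the coefficient of y⁻¹. Both products can be
summed over the supports of b and x, since passing to `constEmb` or `resY` does not enlarge a
support. -/
theorem resY_constEmb_mul (b : HahnSeries ℚ k) (x : HahnSeries ℚ (LaurentSeries k)) :
    resY k (constEmb k b * x) = b * resY k x := by
  ext q
  rw [resY_coeff, HahnSeries.coeff_mul_left' b.isPWO_support,
    HahnSeries.coeff_mul_right' x.isPWO_support]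
  · rw [HahnSeries.coeff_sum]
    refine Finset.sum_congr rfl fun ij _ => ?_
    rw [constEmb, mapHom_coeff, HahnSeries.C_mul_eq_smul, HahnSeries.coeff_smul, smul_eq_mul,
      resY_coeff]
  · intro j hj
    by_contra hx
    rw [HahnSeries.mem_support, not_not] at hx
    exact hj (by rw [resY_coeff, hx, HahnSeries.coeff_zero])
  · exact HahnSeries.support_map_subset b (HahnSeries.C : k →+* LaurentSeries k).toZeroHom

/-- The substitution of `y^{-1}` for the variable of a polynomial. -/
def invY : k[X] →+* LaurentSeries k :=
  eval₂RingHom HahnSeries.C (HahnSeries.single (-1) 1)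

theorem invY_coeff_neg_one (p : k[X]) : (invY p).coeff (-1) = p.coeff 1 := by
  induction p using Polynomial.induction_on' with
  | add p q hp hq => rw [map_add, HahnSeries.coeff_add, hp, hq, coeff_add]
  | monomial n a =>
    rw [invY, coe_eval₂RingHom, eval₂_monomial, HahnSeries.single_pow, one_pow,
      HahnSeries.C_mul_eq_smul, HahnSeries.coeff_smul, HahnSeries.coeff_single, coeff_monomial]
    by_cases h : n = 1
    · subst h; simp
    · have : ¬ ((-1 : ℤ) = n • (-1)) := by simp; omega
      rw [if_neg this, if_neg h, smul_zero]

theorem resY_mapHom_ofPowerSeries (w : HahnSeries ℚ (PowerSeries k)) :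
    resY k (mapHom (HahnSeries.ofPowerSeries ℤ k) w) = 0 := by
  ext q
  rw [resY_coeff, mapHom_coeff, coeff_neg_one_ofPowerSeries, HahnSeries.coeff_zero]

theorem constEmb_eq_mapHom_ofPowerSeries (b : HahnSeries ℚ k) :
    constEmb k b = mapHom (HahnSeries.ofPowerSeries ℤ k) (mapHom PowerSeries.C b) := by
  rw [mapHom_mapHom]
  ext1
  funext q
  simp [constEmb]

theorem yVar_eq_mapHom_ofPowerSeries :
    yVar k = mapHom (HahnSeries.ofPowerSeries ℤ k) (HahnSeries.C PowerSeries.X) := by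
  rw [mapHom_C, HahnSeries.ofPowerSeries_X, yVar]

theorem yVar_sub_constEmb (a : HahnSeries ℚ k) :
    yVar k - constEmb k a = mapHom (HahnSeries.ofPowerSeries ℤ k)
      (HahnSeries.C PowerSeries.X - mapHom PowerSeries.C a) := by
  rw [map_sub, ← yVar_eq_mapHom_ofPowerSeries, constEmb_eq_mapHom_ofPowerSeries]

/-- The lowest coefficient in t of y - a is -a_v, or y - a_0 when v = 0. Its constant term is
nonzero, so it is a unit of k[[y]], and a Hahn series with unit leading coefficient is invertible.
-/
theorem isUnit_C_X_sub {a : HahnSeries ℚ k} (ha : ¬ 0 < a.orderTop) :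
    IsUnit (HahnSeries.C PowerSeries.X - mapHom PowerSeries.C a : HahnSeries ℚ (PowerSeries k)) := by
  set z : HahnSeries ℚ (PowerSeries k) := HahnSeries.C PowerSeries.X - mapHom PowerSeries.C a
    with hz
  have ha0 : a ≠ 0 := by rintro rfl; simp at ha
  have hord : a.order ≤ 0 := by
    rw [HahnSeries.zero_lt_orderTop_iff ha0] at ha
    exact not_lt.1 ha
  have hzc (q : ℚ) : z.coeff q =
      (if q = 0 then PowerSeries.X else 0) - PowerSeries.C (a.coeff q) := by
    rw [hz, HahnSeries.coeff_sub, mapHom_coeff, HahnSeries.C_apply, HahnSeries.coeff_single]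
    congr
  have hcc : PowerSeries.constantCoeff (z.coeff a.order) ≠ 0 := by
    rw [hzc, map_sub, PowerSeries.constantCoeff_C]
    have : PowerSeries.constantCoeff (if a.order = 0 then PowerSeries.X else 0 : PowerSeries k)
        = 0 := by split_ifs <;> simp
    rw [this, zero_sub, neg_ne_zero]
    exact fun h => ha0 (HahnSeries.coeff_order_eq_zero.1 h)
  have hz0 : z.coeff a.order ≠ 0 := fun h => hcc (by rw [h, map_zero])
  have hzo : z.order = a.order := by
    refine le_antisymm (HahnSeries.order_le_of_coeff_ne_zero hz0) ?_
    by_contra! hlt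
    have h1 : z.coeff z.order ≠ 0 := fun h =>
      hz0 (by rw [HahnSeries.coeff_order_eq_zero.1 h, HahnSeries.coeff_zero])
    apply h1
    rw [hzc, if_neg (by linarith : z.order < 0).ne, HahnSeries.coeff_eq_zero_of_lt_order hlt,
      map_zero, sub_zero]
  rw [HahnSeries.isUnit_iff, HahnSeries.leadingCoeff_eq, hzo, PowerSeries.isUnit_iff_constantCoeff]
  exact hcc.isUnit

/-- `1 / (y - a)` is an integral series in `y` if `a` is not small. -/
theorem exists_inv_eq_mapHom_ofPowerSeries {a : HahnSeries ℚ k} (ha : ¬ 0 < a.orderTop) :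
    ∃ w, (yVar k - constEmb k a)⁻¹ = mapHom (HahnSeries.ofPowerSeries ℤ k) w := by
  obtain ⟨w, hw⟩ := (isUnit_C_X_sub ha).exists_right_inv
  refine ⟨w, inv_eq_of_mul_eq_one_right ?_⟩
  rw [yVar_sub_constEmb, ← map_mul, hw, map_one]

theorem resY_inv_pow_of_not_pos {a : HahnSeries ℚ k} (ha : ¬ 0 < a.orderTop) (n : ℕ) :
    resY k ((yVar k - constEmb k a)⁻¹ ^ n) = 0 := by
  obtain ⟨w, hw⟩ := exists_inv_eq_mapHom_ofPowerSeries ha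
  rw [hw, ← map_pow, resY_mapHom_ofPowerSeries]

/-- Here X stands for 1/y. The geometric series in aX converges because a has positive valuation,
and each coefficient in t remains a polynomial in 1/y. -/
theorem isUnit_one_sub_C_X {a : HahnSeries ℚ k} (ha : 0 < a.orderTop) :
    IsUnit (1 - mapHom Polynomial.C a * HahnSeries.C X : HahnSeries ℚ k[X]) := by
  apply HahnSeries.isUnit_of_orderTop_pos
  rw [sub_sub_cancel_left, HahnSeries.orderTop_neg]
  by_contra! h
  obtain ⟨q, hq⟩ := WithTop.ne_top_iff_exists.1 (ne_top_of_le_ne_top WithTop.zero_ne_top h)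
  have h1 := HahnSeries.coeff_orderTop_ne hq.symm
  rw [HahnSeries.C_apply, HahnSeries.coeff_mul_single_zero, mapHom_coeff] at h1
  have h2 : a.coeff q ≠ 0 := fun h => h1 (by rw [h, map_zero, zero_mul])
  rw [← hq] at h
  exact absurd (ha.trans_le (HahnSeries.orderTop_le_of_coeff_ne_zero h2)) h.not_gt

/-- With X = 1/y and u = (1 - aX)⁻¹, the power is X^(j+1) u^(j+1). Its coefficient of X is 0 for j >
0, and for j = 0 it is the value of u at X = 0, namely 1. -/
theorem resY_inv_pow_of_pos {a : HahnSeries ℚ k} (ha : 0 < a.orderTop) (j : ℕ) :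
    resY k ((yVar k - constEmb k a)⁻¹ ^ (j + 1)) = if j = 0 then 1 else 0 := by
  obtain ⟨u, hu⟩ := (isUnit_one_sub_C_X ha).exists_right_inv
  have hXy : yVar k * mapHom invY (HahnSeries.C X) = 1 := by
    rw [mapHom_C, yVar, ← map_mul, invY, coe_eval₂RingHom, eval₂_X, HahnSeries.single_mul_single]
    simp
  have hconst : mapHom invY (mapHom Polynomial.C a) = constEmb k a := by
    rw [mapHom_mapHom]
    ext1
    funext q
    simp [constEmb, invY]
  have hinv : (yVar k - constEmb k a)⁻¹ = mapHom invY (HahnSeries.C X * u) := by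
    apply inv_eq_of_mul_eq_one_right
    have h1 := congr(mapHom (invY (k := k)) $hu)
    rw [map_mul, map_sub, map_mul, map_one, hconst] at h1
    rw [map_mul]
    linear_combination h1 + (mapHom invY u) * hXy
  rw [hinv, ← map_pow]
  ext q
  rw [resY_coeff, mapHom_coeff, invY_coeff_neg_one, mul_pow, ← map_pow, HahnSeries.C_apply,
    HahnSeries.coeff_single_zero_mul, coeff_X_pow_mul']
  rcases Nat.eq_zero_or_pos j with rfl | hj
  · have h1 := congr(mapHom (constantCoeff (R := k)) $hu)
    rw [map_mul, map_sub, map_mul, map_one, mapHom_C, constantCoeff_apply, coeff_X_zero,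
      HahnSeries.C_zero, mul_zero, sub_zero, one_mul] at h1
    have h2 := congr(($h1).coeff q)
    rw [mapHom_coeff] at h2
    simpa using h2
  · rw [if_neg (by omega), if_neg hj.ne', HahnSeries.coeff_zero]

end Functional

/-! ### Partial fractions with split denominator -/

section PartialFractions

/-- The partial fraction decomposition of a fraction with split denominator. -/
theorem exists_partialFractions {L : Type*} [Field L] (f : L[X]) (s : Finset L) (n : L → ℕ) :
    ∃ (q : L[X]) (c : (a : L) → Fin (n a) → L),
      algebraMap L[X] (RatFunc L) f / algebraMap L[X] (RatFunc L) (∏ a ∈ s, (X - C a) ^ n a) =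
        algebraMap L[X] (RatFunc L) q + ∑ a ∈ s, ∑ j : Fin (n a),
          algebraMap L[X] (RatFunc L) (C (c a j)) *
            (algebraMap L[X] (RatFunc L) (X - C a))⁻¹ ^ (j.1 + 1) := by
  obtain ⟨q, r, hr, h⟩ := mul_prod_pow_inverse_eq_quo_add_sum_rem_mul_pow_inverse
    (K := RatFunc L) (s := s) f (g := fun a => X - C a) (fun a _ => monic_X_sub_C a)
    (fun a _ b _ hab => isCoprime_X_sub_C_of_isUnit_sub (sub_ne_zero.2 hab).isUnit) n
    (gi := fun a => (algebraMap L[X] (RatFunc L) (X - C a))⁻¹)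
    (fun a _ => inv_mul_cancel₀ (RatFunc.algebraMap_ne_zero (X_sub_C_ne_zero a)))
  refine ⟨q, fun a j => (r a j).coeff 0, ?_⟩
  rw [div_eq_mul_inv, map_prod, ← Finset.prod_inv_distrib]
  simp only [map_pow, ← inv_pow]
  rw [h]
  congr 1
  refine Finset.sum_congr rfl fun a ha => Finset.sum_congr rfl fun j _ => ?_
  have hd := hr a ha j
  rw [degree_X_sub_C] at hd
  rw [← eq_C_of_degree_le_zero (Order.le_of_lt_succ (by exact_mod_cast hd))]

theorem Splits.eq_prod_pow_rootMultiplicity {L : Type*} [Field L] [DecidableEq L] {d : L[X]}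
    (hd : d.Splits) (hm : d.Monic) :
    d = ∏ a ∈ d.roots.toFinset, (X - C a) ^ d.rootMultiplicity a := by
  conv_lhs => rw [hd.eq_prod_roots_of_monic hm]
  rw [Finset.prod_multiset_map_count]
  simp only [count_roots]

end PartialFractions

/-! ### Laurent expansion at a point -/

section TaylorEmb

variable {L : Type*} [Field L]

/-- The embedding of `L[X]` into `L((z))` that sends `X` to `a + z`. -/
def taylorEmb (a : L) : L[X] →+* LaurentSeries L :=
  (HahnSeries.ofPowerSeries ℤ L).comp
    (Polynomial.coeToPowerSeries.ringHom.comp (taylorAlgHom a : L[X] →+* L[X]))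

theorem taylorEmb_apply (a : L) (p : L[X]) :
    taylorEmb a p = HahnSeries.ofPowerSeries ℤ L (taylor a p : L[X]) := rfl

theorem taylorEmb_injective (a : L) : Function.Injective (taylorEmb a) := by
  intro f g h
  exact taylor_injective a (Polynomial.coe_injective L (HahnSeries.ofPowerSeries_injective h))

theorem taylorEmb_C (a c : L) : taylorEmb a (C c) = HahnSeries.C c := by
  rw [taylorEmb_apply, taylor_C, Polynomial.coe_C, HahnSeries.ofPowerSeries_C]

-- At X = b + z the factor X - a becomes z + (b - a): it is z itself if a = b, and an invertible
-- power series otherwise.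
open Classical in
theorem coeff_taylorEmb_inv_pow (a b : L) (j : ℕ) :
    ((taylorEmb b (X - C a))⁻¹ ^ (j + 1)).coeff (-1) = if a = b ∧ j = 0 then 1 else 0 := by
  have h0 : taylorEmb b (X - C a) =
      HahnSeries.ofPowerSeries ℤ L (PowerSeries.X + PowerSeries.C (b - a)) := by
    rw [taylorEmb_apply, map_sub, taylor_X, taylor_C, Polynomial.coe_sub, Polynomial.coe_add,
      Polynomial.coe_X, Polynomial.coe_C, Polynomial.coe_C, map_sub PowerSeries.C]
    congr 1
    ring
  by_cases hab : a = b
  · subst hab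
    rw [h0, sub_self, map_zero, add_zero, HahnSeries.ofPowerSeries_X, inv_pow,
      HahnSeries.single_pow, one_pow]
    have : (HahnSeries.single ((j + 1) • (1 : ℤ)) (1 : L))⁻¹ =
        HahnSeries.single (-((j + 1) • (1 : ℤ))) 1 := by
      apply inv_eq_of_mul_eq_one_right
      rw [HahnSeries.single_mul_single]
      simp
    rw [this, HahnSeries.coeff_single]
    by_cases hj : j = 0
    · subst hj; simp
    · rw [if_neg (by simp; omega), if_neg (by simp [hj])]
  · rw [if_neg (by simp [hab])]
    have hu : IsUnit (PowerSeries.X + PowerSeries.C (b - a)) := by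
      rw [PowerSeries.isUnit_iff_constantCoeff]
      simpa using sub_ne_zero.2 (Ne.symm hab)
    obtain ⟨w, hw⟩ := hu.exists_right_inv
    have : (taylorEmb b (X - C a))⁻¹ = HahnSeries.ofPowerSeries ℤ L w := by
      apply inv_eq_of_mul_eq_one_right
      rw [h0, ← map_mul, hw, map_one]
    rw [this, ← map_pow, coeff_neg_one_ofPowerSeries]

end TaylorEmb

/-! ### Expansion in y and the residues at small poles -/

section EvalY

variable {k : Type*} [Field k]

variable (k) in
/-- Evaluation at `y` of polynomials with coefficients in `k((t^ℚ))`. -/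
def evalY : (HahnSeries ℚ k)[X] →+* HahnSeries ℚ (LaurentSeries k) :=
  eval₂RingHom (constEmb k) (yVar k)

theorem evalY_C (a : HahnSeries ℚ k) : evalY k (C a) = constEmb k a := eval₂_C _ _

theorem evalY_X : evalY k X = yVar k := eval₂_X _ _

/-- All coefficients of p can be recovered from its value at y, so y is transcendental over k((t^ℚ))
and evaluation extends to fractions. -/
theorem evalY_coeff_coeff (p : (HahnSeries ℚ k)[X]) (q : ℚ) (n : ℕ) :
    ((evalY k p).coeff q).coeff n = (p.coeff n).coeff q := by
  induction p using Polynomial.induction_on' with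
  | add p r hp hr => simp only [map_add, HahnSeries.coeff_add, hp, hr, coeff_add]
  | monomial m a =>
    rw [← C_mul_X_pow_eq_monomial, map_mul, map_pow, evalY_C, evalY_X, yVar, ← map_pow,
      HahnSeries.single_pow, one_pow, HahnSeries.C_apply, HahnSeries.coeff_mul_single_zero,
      constEmb, mapHom_coeff, HahnSeries.C_mul_eq_smul, HahnSeries.coeff_smul,
      HahnSeries.coeff_single, coeff_C_mul, coeff_X_pow]
    by_cases h : n = m
    · subst h; simp
    · rw [if_neg h, if_neg (by simpa using h), smul_zero, mul_zero, HahnSeries.coeff_zero]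

theorem evalY_injective : Function.Injective (evalY k) := by
  rw [injective_iff_map_eq_zero]
  intro p hp
  ext n q
  rw [← evalY_coeff_coeff, hp]
  simp

theorem resY_evalY (p : (HahnSeries ℚ k)[X]) : resY k (evalY k p) = 0 := by
  induction p using Polynomial.induction_on' with
  | add p r hp hr => rw [map_add, map_add, hp, hr, add_zero]
  | monomial m a =>
    rw [← C_mul_X_pow_eq_monomial, map_mul, map_pow, evalY_C, evalY_X, resY_constEmb_mul,
      yVar_eq_mapHom_ofPowerSeries, ← map_pow, resY_mapHom_ofPowerSeries, mul_zero]

open Classical in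
/-- The coefficient of `y^{-1}` of the expansion of a fraction is the sum of its residues at the
small poles. -/
theorem resY_evalY_div (f d : (HahnSeries ℚ k)[X]) (hd : d.Splits) (hm : d.Monic) :
    resY k (evalY k f / evalY k d) =
      ∑ a ∈ d.roots.toFinset with 0 < a.orderTop,
        (taylorEmb a f / taylorEmb a d).coeff (-1) := by
  obtain ⟨q, c, h⟩ := exists_partialFractions f d.roots.toFinset (fun a => d.rootMultiplicity a)
  rw [← Splits.eq_prod_pow_rootMultiplicity hd hm] at h
  -- The decomposition is transported along any injection into a field. It serves both for the
  -- expansion in y and for the Laurent expansion at each pole.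
  have key {E : Type _} [Field E] (e : (HahnSeries ℚ k)[X] →+* E) (he : Function.Injective e) :
      e f / e d = e q + ∑ a ∈ d.roots.toFinset, ∑ j : Fin (d.rootMultiplicity a),
        e (C (c a j)) * (e (X - C a))⁻¹ ^ (j.1 + 1) := by
    have h1 := congr(IsFractionRing.lift (K := RatFunc (HahnSeries ℚ k)) he $h)
    simpa only [map_div₀, map_add, map_sum, map_mul, map_pow, map_inv₀,
      IsFractionRing.lift_algebraMap] using h1
  have hres (b : HahnSeries ℚ k) (hb : b ∈ d.roots.toFinset) :
      (taylorEmb b f / taylorEmb b d).coeff (-1) =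
        ∑ j : Fin (d.rootMultiplicity b), if j.1 = 0 then c b j else 0 := by
    rw [key _ (taylorEmb_injective b), HahnSeries.coeff_add, taylorEmb_apply b q,
      coeff_neg_one_ofPowerSeries, zero_add, HahnSeries.coeff_sum, Finset.sum_eq_single b]
    · rw [HahnSeries.coeff_sum]
      refine Finset.sum_congr rfl fun j _ => ?_
      rw [taylorEmb_C, HahnSeries.C_mul_eq_smul, HahnSeries.coeff_smul, coeff_taylorEmb_inv_pow]
      simp
    · intro a _ hab
      rw [HahnSeries.coeff_sum]
      refine Finset.sum_eq_zero fun j _ => ?_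
      rw [taylorEmb_C, HahnSeries.C_mul_eq_smul, HahnSeries.coeff_smul, coeff_taylorEmb_inv_pow,
        if_neg (by simp [hab]), smul_zero]
    · exact fun h => absurd hb h
  rw [key _ evalY_injective, map_add, resY_evalY, zero_add, map_sum, Finset.sum_filter]
  refine Finset.sum_congr rfl fun a ha => ?_
  rw [map_sum, hres a ha]
  split_ifs with hpos
  · refine Finset.sum_congr rfl fun j _ => ?_
    rw [evalY_C, resY_constEmb_mul, map_sub, evalY_C, evalY_X, resY_inv_pow_of_pos hpos]
    simp
  · refine Finset.sum_eq_zero fun j _ => ?_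
    rw [evalY_C, resY_constEmb_mul, map_sub, evalY_C, evalY_X, resY_inv_pow_of_not_pos hpos,
      mul_zero]

end EvalY

/-! ### The substitution x = t/y in K[[x, y]] -/

section ExpandY

variable (K Kbar : Type*) [Field K] [Field Kbar] [Algebra K Kbar]

variable {K} in
/-- The coefficient of `x^i` in a power series in `x` and `y`, as a power series in `y`. -/
def column (f : MvPowerSeries (Fin 2) K) (i : ℕ) : PowerSeries Kbar :=
  PowerSeries.mk fun j => algebraMap K Kbar
    (MvPowerSeries.coeff (Finsupp.single (0 : Fin 2) i + Finsupp.single (1 : Fin 2) j) f)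

variable {K} in
/-- The substitution of `t / y` for `x`, as a power series in `t` over `k((y))`. -/
def expandYSeries (f : MvPowerSeries (Fin 2) K) : PowerSeries (LaurentSeries Kbar) :=
  PowerSeries.mk fun i => HahnSeries.single (-(i : ℤ)) 1 *
    HahnSeries.ofPowerSeries ℤ Kbar (column Kbar f i)

/-- The substitution of `t / y` for `x` in a power series in `x` and `y`. -/
def expandY : MvPowerSeries (Fin 2) K →+ HahnSeries ℚ (LaurentSeries Kbar) where
  toFun f := HahnSeries.ofPowerSeries ℚ _ (expandYSeries Kbar f)
  map_zero' := by
    rw [← map_zero (HahnSeries.ofPowerSeries ℚ (LaurentSeries Kbar))]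
    congr 1
    ext1 i
    have : column Kbar (0 : MvPowerSeries (Fin 2) K) i = 0 := by ext j; simp [column]
    rw [expandYSeries, PowerSeries.coeff_mk, this, map_zero, mul_zero, map_zero]
  map_add' f g := by
    rw [← map_add]
    congr 1
    ext1 i
    have : column Kbar (f + g) i = column Kbar f i + column Kbar g i := by ext j; simp [column]
    rw [map_add, expandYSeries, expandYSeries, expandYSeries, PowerSeries.coeff_mk,
      PowerSeries.coeff_mk, PowerSeries.coeff_mk, this, map_add, mul_add]

variable {K}

theorem expandY_apply (f : MvPowerSeries (Fin 2) K) :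
    expandY K Kbar f = HahnSeries.ofPowerSeries ℚ _ (expandYSeries Kbar f) := rfl

theorem expandY_one : expandY K Kbar 1 = 1 := by
  rw [expandY_apply, ← map_one (HahnSeries.ofPowerSeries ℚ (LaurentSeries Kbar))]
  congr 1
  ext1 i
  have : column Kbar (1 : MvPowerSeries (Fin 2) K) i = if i = 0 then 1 else 0 := by
    ext j
    rw [column, PowerSeries.coeff_mk, MvPowerSeries.coeff_one]
    by_cases hi : i = 0
    · subst hi
      by_cases hj : j = 0
      · subst hj; simp
      · simp [hj, PowerSeries.coeff_one]
    · rw [if_neg, if_neg hi, map_zero, map_zero]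
      intro h
      have := DFunLike.congr_fun h 0
      simp [hi] at this
  rw [expandYSeries, PowerSeries.coeff_mk, this, PowerSeries.coeff_one]
  by_cases hi : i = 0
  · subst hi; simp
  · rw [if_neg hi, if_neg hi, map_zero, mul_zero]

theorem expandY_C_mul (c : K) (f : MvPowerSeries (Fin 2) K) :
    expandY K Kbar (MvPowerSeries.C c * f) =
      HahnSeries.C (HahnSeries.C (algebraMap K Kbar c)) * expandY K Kbar f := by
  rw [expandY_apply, expandY_apply, ← HahnSeries.ofPowerSeries_C, ← map_mul]
  congr 1
  ext1 i
  have : column Kbar (MvPowerSeries.C c * f) i =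
      PowerSeries.C (algebraMap K Kbar c) * column Kbar f i := by ext j; simp [column]
  rw [PowerSeries.coeff_C_mul, expandYSeries, expandYSeries, PowerSeries.coeff_mk,
    PowerSeries.coeff_mk, this, map_mul, HahnSeries.ofPowerSeries_C]
  ring

theorem expandY_X_zero_mul (f : MvPowerSeries (Fin 2) K) :
    expandY K Kbar (MvPowerSeries.X 0 * f) =
      HahnSeries.single 1 1 * (yVar Kbar)⁻¹ * expandY K Kbar f := by
  rw [inv_yVar, expandY_apply, expandY_apply, ← HahnSeries.ofPowerSeries_C, ← HahnSeries.ofPowerSeries_X,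
    ← map_mul, ← map_mul]
  congr 1
  ext1 i
  rw [mul_assoc]
  rcases i with _ | i
  · rw [PowerSeries.coeff_zero_X_mul, expandYSeries, PowerSeries.coeff_mk]
    have : column Kbar (MvPowerSeries.X 0 * f) 0 = 0 := by
      ext j
      rw [column, PowerSeries.coeff_mk, MvPowerSeries.X, MvPowerSeries.coeff_monomial_mul,
        if_neg, map_zero, map_zero]
      intro h
      have := h 0
      simp at this
    rw [this, map_zero, mul_zero]
  · rw [PowerSeries.coeff_succ_X_mul, PowerSeries.coeff_C_mul, expandYSeries, expandYSeries,
      PowerSeries.coeff_mk, PowerSeries.coeff_mk, ← mul_assoc, HahnSeries.single_mul_single]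
    have : column Kbar (MvPowerSeries.X 0 * f) (i + 1) = column Kbar f i := by
      ext j
      rw [column, column, PowerSeries.coeff_mk, PowerSeries.coeff_mk, Finsupp.single_add,
        add_comm (Finsupp.single 0 i), add_assoc, MvPowerSeries.X,
        MvPowerSeries.coeff_add_monomial_mul, one_mul]
    rw [this]
    congr 2
    · push_cast; ring_nf
    · simp

theorem expandY_X_one_mul (f : MvPowerSeries (Fin 2) K) :
    expandY K Kbar (MvPowerSeries.X 1 * f) = yVar Kbar * expandY K Kbar f := by
  rw [yVar, expandY_apply, expandY_apply, ← HahnSeries.ofPowerSeries_C, ← map_mul]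
  congr 1
  ext1 i
  have : column Kbar (MvPowerSeries.X 1 * f) i = PowerSeries.X * column Kbar f i := by
    ext j
    rcases j with _ | j
    · rw [column, PowerSeries.coeff_mk, MvPowerSeries.X, MvPowerSeries.coeff_monomial_mul,
        if_neg, map_zero, PowerSeries.coeff_zero_X_mul]
      intro h
      have := h 1
      simp at this
    · rw [PowerSeries.coeff_succ_X_mul, column, column, PowerSeries.coeff_mk, PowerSeries.coeff_mk,
        Finsupp.single_add, add_comm (Finsupp.single 1 j), add_left_comm, MvPowerSeries.X,
        MvPowerSeries.coeff_add_monomial_mul, one_mul]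
  rw [PowerSeries.coeff_C_mul, expandYSeries, expandYSeries, PowerSeries.coeff_mk,
    PowerSeries.coeff_mk, this, map_mul, HahnSeries.ofPowerSeries_X]
  ring

variable (K) in
/-- The substitution of `t / y` for `x` in a polynomial in `x` and `y`. -/
def evalXY : MvPolynomial (Fin 2) K →+* HahnSeries ℚ (LaurentSeries Kbar) :=
  MvPolynomial.eval₂Hom (HahnSeries.C.comp (HahnSeries.C.comp (algebraMap K Kbar)))
    ![HahnSeries.single 1 1 * (yVar Kbar)⁻¹, yVar Kbar]

/-- Multiplicativity against polynomials suffices to handle F, because the expansion of F is the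
numerator times the inverse series of the denominator. By induction only constants and the two
variables need checking. -/
theorem expandY_coe_mul (p : MvPolynomial (Fin 2) K) (f : MvPowerSeries (Fin 2) K) :
    expandY K Kbar (p * f) = evalXY K Kbar p * expandY K Kbar f := by
  induction p using MvPolynomial.induction_on generalizing f with
  | C a =>
    rw [MvPolynomial.coe_C, expandY_C_mul]
    simp [evalXY]
  | add p q hp hq => rw [MvPolynomial.coe_add, add_mul, map_add, hp, hq, map_add, add_mul]
  | mul_X p n hp =>
    rw [MvPolynomial.coe_mul, MvPolynomial.coe_X, mul_assoc, hp,
      map_mul (evalXY K Kbar), mul_assoc]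
    congr 1
    fin_cases n
    · refine (expandY_X_zero_mul Kbar f).trans ?_
      simp [evalXY]
    · refine (expandY_X_one_mul Kbar f).trans ?_
      simp [evalXY]

theorem resY_ofPowerSeries (g : PowerSeries (LaurentSeries Kbar)) :
    resY Kbar (HahnSeries.ofPowerSeries ℚ _ g) = HahnSeries.ofPowerSeries ℚ Kbar
      (PowerSeries.mk fun n => (PowerSeries.coeff n g).coeff (-1)) := by
  ext q
  rw [resY_coeff]
  by_cases hq : ∃ n : ℕ, (n : ℚ) = q
  · obtain ⟨n, rfl⟩ := hq
    rw [HahnSeries.ofPowerSeries_apply_coeff, HahnSeries.ofPowerSeries_apply_coeff,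
      PowerSeries.coeff_mk]
  · rw [HahnSeries.ofPowerSeries_apply, HahnSeries.ofPowerSeries_apply,
      HahnSeries.embDomain_of_notMem_range, HahnSeries.embDomain_of_notMem_range,
      HahnSeries.coeff_zero]
    · exact fun ⟨n, hn⟩ => hq ⟨n, hn⟩
    · exact fun ⟨n, hn⟩ => hq ⟨n, hn⟩

/-- The coefficient of t^n on the left is y^(-1-n) ∑ a_{n,j} y^j before the functional is applied,
and y⁻¹ selects j = n. -/
theorem resY_inv_yVar_mul_expandY (f : MvPowerSeries (Fin 2) K) :
    resY Kbar ((yVar Kbar)⁻¹ * expandY K Kbar f) = embSeries K Kbar (diagSeries f) := by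
  rw [inv_yVar, expandY_apply, ← HahnSeries.ofPowerSeries_C, ← map_mul, resY_ofPowerSeries, embSeries,
    RingHom.comp_apply]
  congr 1
  ext n
  rw [PowerSeries.coeff_mk, PowerSeries.coeff_map, diagSeries, PowerSeries.coeff_mk,
    PowerSeries.coeff_C_mul, expandYSeries, PowerSeries.coeff_mk, ← mul_assoc,
    HahnSeries.single_mul_single, HahnSeries.coeff_single_mul, mul_one, one_mul]
  have : (-1 : ℤ) - (-1 + -(n : ℤ)) = n := by ring
  rw [this]
  refine (HahnSeries.ofPowerSeries_apply_coeff (Γ := ℤ) _ n).trans ?_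
  rw [column, PowerSeries.coeff_mk]

end ExpandY

/-! ### The embedding of K(t)(y) and the image of G -/

section Main

variable (K Kbar : Type*) [Field K] [Field Kbar] [Algebra K Kbar]

theorem evalY_comp_map_injective :
    Function.Injective ((evalY Kbar).comp (mapRingHom (embRat K Kbar))) :=
  evalY_injective.comp (Polynomial.map_injective _ (embRat K Kbar).injective)

/-- The embedding of `K(t)(y)` into the series in `t` over the Laurent series in `y`. -/
def embBivariate : RatFunc (RatFunc K) →+* HahnSeries ℚ (LaurentSeries Kbar) :=
  IsFractionRing.lift (A := (RatFunc K)[X]) (evalY_comp_map_injective K Kbar)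

variable {K}

theorem embBivariate_algebraMap (p : (RatFunc K)[X]) :
    embBivariate K Kbar (algebraMap _ _ p) = evalY Kbar (p.map (embRat K Kbar)) :=
  IsFractionRing.lift_algebraMap _ _

theorem embBivariate_C (r : RatFunc K) :
    embBivariate K Kbar (RatFunc.C r) = constEmb Kbar (embRat K Kbar r) := by
  rw [← RatFunc.algebraMap_C, embBivariate_algebraMap, map_C, evalY_C]

theorem embBivariate_X : embBivariate K Kbar RatFunc.X = yVar Kbar := by
  rw [← RatFunc.algebraMap_X, embBivariate_algebraMap, map_X, evalY_X]

theorem embRat_algebraMap (p : K[X]) :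
    embRat K Kbar (algebraMap _ _ p) = embPoly K Kbar p :=
  IsFractionRing.lift_algebraMap _ _

theorem embRat_C (c : K) : embRat K Kbar (RatFunc.C c) = HahnSeries.C (algebraMap K Kbar c) := by
  rw [← RatFunc.algebraMap_C, embRat_algebraMap]
  simp [embPoly, embSeries]

theorem embRat_X : embRat K Kbar RatFunc.X = HahnSeries.single 1 1 := by
  rw [← RatFunc.algebraMap_X, embRat_algebraMap]
  simp [embPoly, embSeries]

theorem embBivariate_substPoly (p : MvPolynomial (Fin 2) K) :
    embBivariate K Kbar (substPoly p) = evalXY K Kbar p := by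
  rw [substPoly, MvPolynomial.hom_eval₂, evalXY, MvPolynomial.coe_eval₂Hom]
  congr 1
  · ext c
    simp only [RingHom.comp_apply, embBivariate_C, embRat_C, constEmb, mapHom_C]
  · refine funext (Fin.forall_fin_two.2 ⟨?_, ?_⟩)
    · change embBivariate K Kbar (RatFunc.C (RatFunc.X : RatFunc K) / RatFunc.X) =
        HahnSeries.single 1 1 * (yVar Kbar)⁻¹
      rw [map_div₀, embBivariate_C, embBivariate_X, embRat_X, div_eq_mul_inv, constEmb]
      congr 1
      exact HahnSeries.map_single (HahnSeries.C : Kbar →+* LaurentSeries Kbar).toZeroHom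
    · exact embBivariate_X Kbar

/-- Since the denominator does not vanish at the origin, it has an inverse in K[[x, y]], and
substitution sends that series to the inverse of the denominator's image. Thus expanding commutes
with forming the fraction. -/
theorem embBivariate_G (F : RatFunc₂ K)
    (hF : MvPolynomial.eval (fun _ => (0 : K)) (denom F) ≠ 0) :
    embBivariate K Kbar (G F) = (yVar Kbar)⁻¹ * expandY K Kbar (expansion F) := by
  have hc : MvPowerSeries.constantCoeff (denom F : MvPowerSeries (Fin 2) K) ≠ 0 := by
    rw [← MvPowerSeries.coeff_zero_eq_constantCoeff_apply, MvPolynomial.coeff_coe]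
    rwa [← MvPolynomial.constantCoeff_eq, ← MvPolynomial.eval_zero]
  have h1 : evalXY K Kbar (denom F) *
      expandY K Kbar (denom F : MvPowerSeries (Fin 2) K)⁻¹ = 1 := by
    rw [← expandY_coe_mul, MvPowerSeries.mul_inv_cancel _ hc, expandY_one]
  rw [G, map_mul, map_div₀, map_div₀, map_one, embBivariate_X, embBivariate_substPoly,
    embBivariate_substPoly, one_div, expansion, expandY_coe_mul, div_eq_mul_inv,
    inv_eq_of_mul_eq_one_right h1]

end Main

end DiagonalResidues

end

theorem mainTheorem6 {K Kbar : Type*} [Field K] [CharZero K] [Field Kbar] [Algebra K Kbar]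
    [IsAlgClosure K Kbar] (F : DiagonalResidues.RatFunc₂ K)
    (hF : MvPolynomial.eval (fun _ => (0 : K)) (DiagonalResidues.denom F) ≠ 0) :
    ((DiagonalResidues.G F).denom.map (DiagonalResidues.embRat K Kbar)).Splits ∧
    (∃ N : ℕ, 0 < N ∧
      ∀ a ∈ DiagonalResidues.poles (DiagonalResidues.embRat K Kbar) (DiagonalResidues.G F),
        DiagonalResidues.IsLaurentInRoot N a) ∧
    DiagonalResidues.embSeries K Kbar (DiagonalResidues.Diag F) =
      ∑ a ∈ DiagonalResidues.smallBranches Kbar F,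
        DiagonalResidues.residue (DiagonalResidues.embRat K Kbar) (DiagonalResidues.G F) a := by
  classical
  have : IsAlgClosed Kbar := IsAlgClosure.isAlgClosed K
  have : CharZero Kbar := charZero_of_injective_algebraMap (algebraMap K Kbar).injective
  obtain ⟨hs, hr⟩ := DiagonalResidues.splits_of_coeff_mem_puiseux
    (f := (DiagonalResidues.G F).denom.map (DiagonalResidues.embRat K Kbar)) fun i => by
      rw [Polynomial.coeff_map]
      exact DiagonalResidues.embRat_mem_puiseux K Kbar _
  refine ⟨hs, DiagonalResidues.exists_pos_forall_isLaurentInRoot _ fun a ha =>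
    hr a (Multiset.mem_toFinset.1 ha), ?_⟩
  rw [DiagonalResidues.Diag, ← DiagonalResidues.resY_inv_yVar_mul_expandY,
    ← DiagonalResidues.embBivariate_G Kbar F hF]
  conv_lhs => rw [← RatFunc.num_div_denom (DiagonalResidues.G F)]
  rw [map_div₀, DiagonalResidues.embBivariate_algebraMap, DiagonalResidues.embBivariate_algebraMap,
    DiagonalResidues.resY_evalY_div _ _ hs ((RatFunc.monic_denom _).map _)]
  -- `residue` is by definition the coefficient of z⁻¹ in the quotient of the `taylorEmb` images,
  -- and `smallBranches` is the same filtered set of roots.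
  rfl
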